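/- Let $n\ge 1$. For each bidder $i=1,\dots,n$ let the type $\theta_i$ be drawn, independently across bidders, from a compact interval $[a_i,b_i]\subset[0,\infty)$, $a_i<b_i$, with a continuous, strictly positive density $f_i$ and distribution function $F_i$, and suppose that all intervals have the same upper endpoint, $b_1=\dots=b_n$. Suppose that Myerson's virtual value $\theta-\frac{1-F_i(\theta)}{f_i(\theta)}$ is strictly increasing on $[a_i,b_i]$ for every $i$. Let $\zeta_i(u)$ be this virtual value at $\theta=F_i^{-1}(u)$, $u\in[0,1]$, let $H_i(x,u)=\zeta_i(u)\,x$, and $$R_i(\delta,t)=\int_0^\delta\frac{\partial H_i}{\partial x}\bigl(e^{\tau-t},e^{-\tau}\bigr)\,d\tau=\int_0^\delta\zeta_i(e^{-\tau})\,d\tau,\qquad \delta\ge 0 .$$ A reduced form is a tuple $\boldsymbol x=(x_1,\dots,x_n)$ of CDFs on $[0,1]$ (weakly increasing, right-continuous, nonnegative, $x_i(1)=1$). It is feasible if $\prod_i u_i+\sum_i\int_{u_i}^1x_i(u)\,du\le 1$ for all $\boldsymbol u\in[0,1]^n$, and optimal if it maximizes $\sum_i\int_0^1H_i(x_i(u),u)\,du$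 among feasible reduced forms. The $\delta$-transform of a CDF $x$ is $t\mapsto-\ln\psi(e^{-t})$, $t\ge0$, where $\psi(\iota)=\sup\{u\in[0,1]:u\,x(u)\le\iota\}$. Then: 1. For every $t\ge 0$ there is exactly one $(\boldsymbol\delta^\sharp(t),p^\sharp(t))\in[0,\infty)^n\times\mathbf R$ with $$\frac{\partial R_i}{\partial\delta}(\delta_i^\sharp(t),t)=p^\sharp(t)\ \ (i=1,\dots,n),\qquad \sum_{i=1}^n\delta_i^\sharp(t)=t,$$ where the derivative is one-sided at $\delta=0$. 2. Let $T=\inf\{t\ge0:p^\sharp(t)\le0\}\in[0,\infty]$. There is an optimal reduced form $\boldsymbol x^*$ whose $\delta$-transforms are $\delta_i^*(t)=\delta_i^\sharp(t)$ for $t\le T$ and $\delta_i^*(t)=\delta_i^\sharp(T)$ for $t>T$, and it is the only optimal reduced form. 3. $\boldsymbol x^*$ is induced by the score allocation with scores $\zeta_i$ (which are strictly increasing and right-continuous): give the good to bidder $i$ if $\zeta_i(u_i)\ge0$ and $\zeta_i(u_i)>\zeta_j(u_j)$ for all $j\ne i$, and to nobody if there is no such bidder. That is, for all $i$ and all $u\in[0,1]$,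 $x_i^*(u)$ is the probability that bidder $i$ receives the good when $u_i=u$ and the other quantiles are independent and uniform on $[0,1]$. -/

import Mathlib

open Set MeasureTheory

noncomputable section

/-! ### Reduced forms in the quantile space -/

/-- `x` (only its values on `[0,1]` matter) is a cumulative distribution function on the unit
interval: nonnegative, weakly increasing, right-continuous, with `x 1 = 1`. -/
structure IsUnitCDF (x : ℝ → ℝ) : Prop where
  nonneg : ∀ u ∈ Icc (0 : ℝ) 1, 0 ≤ x u
  mono : MonotoneOn x (Icc 0 1)
  right_cont : ∀ u ∈ Icc (0 : ℝ) 1, ContinuousWithinAt x (Icc u 1) u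
  one : x 1 = 1

/-- The left-hand side of Border's constraint. -/
def border {n : ℕ} (x : Fin n → ℝ → ℝ) (u : Fin n → ℝ) : ℝ :=
  ∏ i, u i + ∑ i, ∫ w in (u i)..1, x i w

/-- A tuple of CDFs (a reduced form) that satisfies all of Border's constraints. -/
def IsFeasibleReducedForm {n : ℕ} (x : Fin n → ℝ → ℝ) : Prop :=
  (∀ i, IsUnitCDF (x i)) ∧
    ∀ u : Fin n → ℝ, (∀ i, u i ∈ Icc (0 : ℝ) 1) → border x u ≤ 1

/-- The auctioneer's expected revenue `∑ i, ∫₀¹ H_i(x_i(u), u) du`. -/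
def revenue {n : ℕ} (H : Fin n → ℝ → ℝ → ℝ) (x : Fin n → ℝ → ℝ) : ℝ :=
  ∑ i, ∫ u in (0 : ℝ)..1, H i (x i u) u

/-- An optimal reduced form for the revenue functions `H i x u`. -/
def IsOptimalReducedForm {n : ℕ} (H : Fin n → ℝ → ℝ → ℝ) (x : Fin n → ℝ → ℝ) : Prop :=
  IsFeasibleReducedForm x ∧
    ∀ y : Fin n → ℝ → ℝ, IsFeasibleReducedForm y → revenue H y ≤ revenue H x

/-! ### The transforms of a CDF -/

/-- The right-continuous inverse of `u ↦ u x(u)` on `[0,1]`. -/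
def psiTransform (x : ℝ → ℝ) (ι : ℝ) : ℝ :=
  sSup {u : ℝ | u ∈ Icc (0 : ℝ) 1 ∧ u * x u ≤ ι}

/-- The `δ`-transform `t ↦ -ln ψ(e^{-t})`. -/
def deltaTransform (x : ℝ → ℝ) (t : ℝ) : ℝ :=
  -Real.log (psiTransform x (Real.exp (-t)))

/-! ### The marginal revenue system -/

/-- `R_i(δ,t) = ∫₀^δ (∂H_i/∂x)(e^{τ-t}, e^{-τ}) dτ`. -/
def transformedRevenue {n : ℕ} (H : Fin n → ℝ → ℝ → ℝ) (i : Fin n) (δ t : ℝ) : ℝ :=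
  ∫ τ in (0 : ℝ)..δ, deriv (fun x => H i x (Real.exp (-τ))) (Real.exp (τ - t))

/-- `(δ, p)` solves, at time `t`, the system `∂R_i/∂δ (δ_i, t) = p` for all `i`, `∑ δ_i = t`.
As `R_i(·, t)` lives on `[0, ∞)`, each `δ_i` is nonnegative and the derivative is taken within
`[0, ∞)` (so it is one-sided exactly at `0`). -/
def SolvesSystem {n : ℕ} (H : Fin n → ℝ → ℝ → ℝ) (t : ℝ) (δ : Fin n → ℝ) (p : ℝ) : Prop :=
  (∀ i, 0 ≤ δ i) ∧
    (∀ i, HasDerivWithinAt (fun d => transformedRevenue H i d t) p (Ici 0) (δ i)) ∧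
    ∑ i, δ i = t

/-- The cutoff time `inf {t ≥ 0 : p(t) ≤ 0}`, equal to `∞` when there is no such `t`. -/
def cutoffTime (p : ℝ → ℝ) : EReal :=
  sInf ((fun t : ℝ => (t : EReal)) '' {t : ℝ | 0 ≤ t ∧ p t ≤ 0})

open Classical in
/-- The path `δ` followed up to time `T` and constant afterwards. -/
def frozenPath (δ : ℝ → ℝ) (T : EReal) (t : ℝ) : ℝ :=
  if (t : EReal) ≤ T then δ t else δ T.toReal

/-! ### Allocations -/

/-- An allocation on the cube of quantile profiles. -/
def IsAllocation {n : ℕ} (z : (Fin n → ℝ) → Fin n → ℝ) : Prop :=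
  ∀ u ∈ Icc (0 : Fin n → ℝ) 1, (∀ i, z u i ∈ Icc (0 : ℝ) 1) ∧ ∑ i, z u i ≤ 1

/-- The allocation `z` induces `x`: the expectation of `z_i`, given that bidder `i`'s quantile is
`u` and with the quantiles of the others independent and uniform, is `x_i(u)`. -/
def Induces {n : ℕ} (z : (Fin n → ℝ) → Fin n → ℝ) (x : Fin n → ℝ → ℝ) : Prop :=
  IsAllocation z ∧ ∀ i, ∀ u ∈ Icc (0 : ℝ) 1,
    IntegrableOn (fun w : Fin n → ℝ => z (Function.update w i u) i) (Icc 0 1) ∧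
      x i u = ∫ w in Icc (0 : Fin n → ℝ) 1, z (Function.update w i u) i

/-- Scores: strictly increasing and right-continuous on `[0,1]`. -/
def IsScore (q : ℝ → ℝ) : Prop :=
  StrictMonoOn q (Icc 0 1) ∧ ∀ u ∈ Icc (0 : ℝ) 1, ContinuousWithinAt q (Icc u 1) u

open Classical in
/-- The good goes to the bidder with the (strictly) highest score, if it is nonnegative. -/
def scoreAllocation {n : ℕ} (q : Fin n → ℝ → ℝ) (u : Fin n → ℝ) (i : Fin n) : ℝ :=
  if (∀ j, j ≠ i → q j (u j) < q i (u i)) ∧ 0 ≤ q i (u i) then 1 else 0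

/-! ### The linear model -/

/-- Independent private types: bidder `i`'s type lies in the compact interval
`[lo i, hi i] ⊆ [0, ∞)` and has there a continuous and strictly positive density. -/
structure TypeDistributions (n : ℕ) where
  lo : Fin n → ℝ
  hi : Fin n → ℝ
  density : Fin n → ℝ → ℝ
  lo_nonneg : ∀ i, 0 ≤ lo i
  lo_lt_hi : ∀ i, lo i < hi i
  density_cont : ∀ i, ContinuousOn (density i) (Icc (lo i) (hi i))
  density_pos : ∀ i, ∀ θ ∈ Icc (lo i) (hi i), 0 < density i θ
  density_integral : ∀ i, ∫ θ in (lo i)..(hi i), density i θ = 1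

namespace TypeDistributions

variable {n : ℕ} (A : TypeDistributions n)

/-- The distribution function of bidder `i`'s type, on `[lo i, hi i]`. -/
def cdf (i : Fin n) (θ : ℝ) : ℝ := ∫ s in (A.lo i)..θ, A.density i s

/-- The type with a given quantile: the inverse of `cdf i : [lo i, hi i] → [0,1]`. -/
def quantile (i : Fin n) : ℝ → ℝ :=
  Function.invFunOn (A.cdf i) (Icc (A.lo i) (A.hi i))

/-- Myerson's virtual value of a type. -/
def virtualValue (i : Fin n) (θ : ℝ) : ℝ := θ - (1 - A.cdf i θ) / A.density i θ

/-- Revenue from selling with probability `x` to the type `θ`, with linear utilities. -/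
def linearJ (i : Fin n) (x θ : ℝ) : ℝ := A.virtualValue i θ * x

/-- Revenue from selling with probability `x` to the type with quantile `u`. -/
def linearH (i : Fin n) (x u : ℝ) : ℝ := A.linearJ i x (A.quantile i u)

/-- Myerson's virtual value as a function of the quantile. -/
def quantileVirtualValue (i : Fin n) (u : ℝ) : ℝ := A.virtualValue i (A.quantile i u)

end TypeDistributions

end

/-! Regularity makes each quantile virtual value continuous and strictly increasing, so on `[0,1]`
it agrees with an order isomorphism `V i` of the line. All `V i 1` equal the common upper endpoint
`b`, because the virtual value has no distortion at the top. Write `G_i(s) = max(0, V_i⁻¹(s))`, the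
probability that bidder `i` scores below `s ≤ b`. The system says `V_i(e^{-δ_i}) = p` with `∑ δ_i =
t`, that is, `∏ V_i⁻¹(p) = e^{-t}`: one equation in `p`, solved by the intermediate value theorem
and uniquely by monotonicity. The candidate is `x_i(u) = ∏_{j≠i} G_j(V_i(u))` where `V_i(u) ≥ 0`,
and `0` elsewhere. Its Border integrals are volumes of disjoint winning regions outside the box
`[0,u]`, which gives feasibility; they fill that complement when `u = G(s)` with `s ∈ [0,b]`, so
Border's constraint binds along this path. Layer-cake integration in the score level writes the
revenue of any `y` as `∫₀ᵇ (1 - ∏ G_i(s)) ds`, minus the integrated Border slack of `y` along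
`G(s)`, minus the loss from serving negative scores (`sum_integral_score_mul`). Both penalties are
nonnegative and vanish for the candidate. If they vanish for `y`, perturbing one coordinate of a
binding constraint pins down `y` (`eqOn_scoreReducedForm`). Finally `u x_i(u) = ∏_j G_j(V_i(u))`,
which equals `e^{-t}` at `u = e^{-δ_i(t)}` as long as the price is nonnegative. This identifies the
transforms. -/

/-! ### Scores as order isomorphisms of the line -/

/-- A continuous strictly increasing function on a compact interval extends to an order
isomorphism of the real line. -/
theorem exists_orderIso_eqOn {f : ℝ → ℝ} {a b : ℝ} (hab : a ≤ b)
    (hc : ContinuousOn f (Icc a b)) (hm : StrictMonoOn f (Icc a b)) :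
    ∃ e : ℝ ≃o ℝ, EqOn e f (Icc a b) := by
  -- Outside `[a,b]` the extension continues with slope one, which makes it strictly increasing and
  -- onto.
  let g : ℝ → ℝ := fun x => f (projIcc a b hab x) + (x - projIcc a b hab x)
  have hgc : Continuous g := by
    have h1 : Continuous fun x => f (projIcc a b hab x) :=
      hc.comp_continuous (continuous_subtype_val.comp continuous_projIcc) fun x => (projIcc a b hab x).2
    have h2 : Continuous fun x => (projIcc a b hab x : ℝ) :=
      continuous_subtype_val.comp continuous_projIcc
    exact h1.add (continuous_id.sub h2)
  have hgm : StrictMono g := by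
    intro x y hxy
    have hle : projIcc a b hab x ≤ projIcc a b hab y := monotone_projIcc hab hxy.le
    have hd : (projIcc a b hab y : ℝ) - projIcc a b hab x ≤ y - x := by
      simp only [coe_projIcc]
      rcases max_cases a (min b y) with h | h <;> rcases max_cases a (min b x) with h' | h' <;>
        rcases min_cases b x with h2 | h2 <;> rcases min_cases b y with h3 | h3 <;> linarith
    rcases hle.lt_or_eq with h | h
    · have := hm (projIcc a b hab x).2 (projIcc a b hab y).2 h
      simp only [g]; linarith
    · simp only [g, h]; linarith
  have hga : ∀ x ≤ a, g x = f a + (x - a) := fun x hx => by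
    simp only [g, projIcc_of_le_left hab hx]
  have hgb : ∀ x, b ≤ x → g x = f b + (x - b) := fun x hx => by
    simp only [g, projIcc_of_right_le hab hx]
  have hs : Function.Surjective g := by
    refine hgc.surjective ?_ ?_
    · refine Filter.tendsto_atTop.2 fun c => ?_
      filter_upwards [Filter.eventually_ge_atTop (max b (c - f b + b))] with x hx
      rw [hgb x (le_trans (le_max_left _ _) hx)]
      linarith [le_trans (le_max_right _ _) hx]
    · refine Filter.tendsto_atBot.2 fun c => ?_
      filter_upwards [Filter.eventually_le_atBot (min a (c - f a + a))] with x hx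
      rw [hga x (hx.trans (min_le_left _ _))]
      linarith [hx.trans (min_le_right _ _)]
  refine ⟨hgm.orderIsoOfSurjective g hs, fun x hx => ?_⟩
  simp only [StrictMono.coe_orderIsoOfSurjective, g, projIcc_of_mem hab hx]
  simp

namespace TypeDistributions

variable {n : ℕ} (A : TypeDistributions n)

theorem intervalIntegrable_density (i : Fin n) {s t : ℝ} (hs : s ∈ Icc (A.lo i) (A.hi i))
    (ht : t ∈ Icc (A.lo i) (A.hi i)) : IntervalIntegrable (A.density i) volume s t :=
  ((A.density_cont i).mono (uIcc_subset_Icc hs ht)).intervalIntegrable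

theorem strictMonoOn_cdf (i : Fin n) : StrictMonoOn (A.cdf i) (Icc (A.lo i) (A.hi i)) := by
  intro s hs t ht hst
  have hl : A.lo i ∈ Icc (A.lo i) (A.hi i) := left_mem_Icc.2 (A.lo_lt_hi i).le
  have h := intervalIntegral.integral_add_adjacent_intervals
    (A.intervalIntegrable_density i hl hs) (A.intervalIntegrable_density i hs ht)
  have hpos : 0 < ∫ θ in s..t, A.density i θ :=
    intervalIntegral.intervalIntegral_pos_of_pos_on (A.intervalIntegrable_density i hs ht)
      (fun θ hθ => A.density_pos i θ ⟨hs.1.trans hθ.1.le, hθ.2.le.trans ht.2⟩) hst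
  simp only [cdf]
  linarith

theorem continuousOn_cdf (i : Fin n) : ContinuousOn (A.cdf i) (Icc (A.lo i) (A.hi i)) := by
  have h := intervalIntegral.continuousOn_primitive_interval (μ := volume) (a := A.lo i)
    (b := A.hi i) (f := A.density i) (by
      rw [uIcc_of_le (A.lo_lt_hi i).le]
      exact (A.density_cont i).integrableOn_compact isCompact_Icc)
  rwa [uIcc_of_le (A.lo_lt_hi i).le] at h

theorem continuousOn_virtualValue (i : Fin n) :
    ContinuousOn (A.virtualValue i) (Icc (A.lo i) (A.hi i)) :=
  continuousOn_id.sub ((continuousOn_const.sub (A.continuousOn_cdf i)).div (A.density_cont i)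
    fun θ hθ => (A.density_pos i θ hθ).ne')

theorem exists_orderIso_quantile (i : Fin n) :
    ∃ e : ℝ ≃o ℝ, e 0 = A.lo i ∧ e 1 = A.hi i ∧ EqOn (A.quantile i) e (Icc 0 1) := by
  obtain ⟨e, he⟩ := exists_orderIso_eqOn (A.lo_lt_hi i).le (A.continuousOn_cdf i)
    (A.strictMonoOn_cdf i)
  have h0 : e (A.lo i) = 0 := by
    rw [he (left_mem_Icc.2 (A.lo_lt_hi i).le)]; simp [cdf]
  have h1 : e (A.hi i) = 1 := by
    rw [he (right_mem_Icc.2 (A.lo_lt_hi i).le)]; exact A.density_integral i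
  have h0' : e.symm 0 = A.lo i := by rw [← h0, e.symm_apply_apply]
  have h1' : e.symm 1 = A.hi i := by rw [← h1, e.symm_apply_apply]
  refine ⟨e.symm, h0', h1', fun u hu => ?_⟩
  have hmem : e.symm u ∈ Icc (A.lo i) (A.hi i) :=
    ⟨h0' ▸ e.symm.monotone hu.1, h1' ▸ e.symm.monotone hu.2⟩
  have himg : u ∈ A.cdf i '' Icc (A.lo i) (A.hi i) :=
    ⟨e.symm u, hmem, by rw [← he hmem, e.apply_symm_apply]⟩
  have hq := Function.invFunOn_mem himg
  have hq' := Function.invFunOn_eq himg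
  exact (A.strictMonoOn_cdf i).injOn hq hmem
    (hq'.trans (by rw [← he hmem, e.apply_symm_apply]))

/-- For regular type distributions, the virtual value as a function of the quantile extends to an
order isomorphism of the real line. -/
theorem exists_orderIso_quantileVirtualValue (i : Fin n)
    (hReg : StrictMonoOn (A.virtualValue i) (Icc (A.lo i) (A.hi i))) :
    ∃ V : ℝ ≃o ℝ, V 1 = A.hi i ∧ EqOn (A.quantileVirtualValue i) V (Icc 0 1) := by
  obtain ⟨e, h0, h1, he⟩ := A.exists_orderIso_quantile i
  have hmaps : MapsTo e (Icc 0 1) (Icc (A.lo i) (A.hi i)) := fun u hu =>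
    ⟨h0 ▸ e.monotone hu.1, h1 ▸ e.monotone hu.2⟩
  have heq : EqOn (A.quantileVirtualValue i) (A.virtualValue i ∘ e) (Icc 0 1) := fun u hu => by
    simp only [quantileVirtualValue, Function.comp, he hu]
  have hc : ContinuousOn (A.virtualValue i ∘ e) (Icc 0 1) :=
    (A.continuousOn_virtualValue i).comp e.continuous.continuousOn hmaps
  have hm : StrictMonoOn (A.virtualValue i ∘ e) (Icc 0 1) :=
    hReg.comp (e.strictMono.strictMonoOn _) hmaps
  obtain ⟨V, hV⟩ := exists_orderIso_eqOn zero_le_one hc hm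
  refine ⟨V, ?_, heq.trans hV.symm⟩
  -- At the top type the term `(1 - F)/f` vanishes, so a common upper endpoint is a common highest
  -- score.
  have hcdf : A.cdf i (A.hi i) = 1 := A.density_integral i
  rw [hV (right_mem_Icc.2 zero_le_one), Function.comp, h1, virtualValue, hcdf]
  simp

end TypeDistributions

/-! ### The marginal revenue system -/

theorem transformedRevenue_linear {n : ℕ} {H : Fin n → ℝ → ℝ → ℝ} {V : Fin n → ℝ ≃o ℝ}
    (hH : ∀ i x, ∀ u ∈ Icc (0 : ℝ) 1, H i x u = V i u * x) (i : Fin n) {δ : ℝ} (hδ : 0 ≤ δ)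
    (t : ℝ) : transformedRevenue H i δ t = ∫ τ in (0 : ℝ)..δ, V i (Real.exp (-τ)) := by
  refine intervalIntegral.integral_congr fun τ hτ => ?_
  rw [uIcc_of_le hδ] at hτ
  have hu : Real.exp (-τ) ∈ Icc (0 : ℝ) 1 :=
    ⟨(Real.exp_pos _).le, Real.exp_le_one_iff.2 (by linarith [hτ.1])⟩
  simp only [hH i _ _ hu]
  simp

/-- By the fundamental theorem of calculus the marginal revenue is the score at quantile `e^{-δ}`;
derivatives within `[0,∞)` are unique even at the endpoint `0`. -/
theorem solvesSystem_iff {n : ℕ} {H : Fin n → ℝ → ℝ → ℝ} {V : Fin n → ℝ ≃o ℝ}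
    (hH : ∀ i x, ∀ u ∈ Icc (0 : ℝ) 1, H i x u = V i u * x) {t : ℝ} {δ : Fin n → ℝ} {p : ℝ} :
    SolvesSystem H t δ p ↔
      (∀ i, 0 ≤ δ i) ∧ (∀ i, V i (Real.exp (-δ i)) = p) ∧ ∑ i, δ i = t := by
  refine and_congr_right fun hδ => and_congr_left fun _ => forall_congr' fun i => ?_
  have hcont : Continuous fun τ => V i (Real.exp (-τ)) :=
    (V i).continuous.comp (Real.continuous_exp.comp continuous_neg)
  have h : HasDerivWithinAt (fun d => transformedRevenue H i d t) (V i (Real.exp (-δ i)))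
      (Ici 0) (δ i) :=
    (hcont.integral_hasStrictDerivAt 0 (δ i)).hasDerivAt.hasDerivWithinAt.congr
      (fun d hd => transformedRevenue_linear hH i hd t) (transformedRevenue_linear hH i (hδ i) t)
  refine ⟨fun h' => ?_, fun h' => h' ▸ h⟩
  exact UniqueDiffWithinAt.eq_deriv _ (uniqueDiffOn_Ici 0 (δ i) (hδ i)) h h'

section System

variable {n : ℕ} {V : Fin n → ℝ ≃o ℝ} {b : ℝ}

/-- A price that did not fall would make every `δ i` weakly smaller, and so their sum. -/
theorem system_price_lt {t t' p p' : ℝ} {δ δ' : Fin n → ℝ}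
    (h : ∀ i, V i (Real.exp (-δ i)) = p) (hs : ∑ i, δ i = t)
    (h' : ∀ i, V i (Real.exp (-δ' i)) = p') (hs' : ∑ i, δ' i = t') (htt : t < t') : p' < p := by
  by_contra! hp
  have : ∀ i, δ' i ≤ δ i := fun i => by
    have := hp
    rw [← h i, ← h' i, (V i).le_iff_le, Real.exp_le_exp] at this
    linarith
  have := Finset.sum_le_sum fun i (_ : i ∈ Finset.univ) => this i
  linarith

theorem system_unique {t p p' : ℝ} {δ δ' : Fin n → ℝ} (hn : 0 < n)
    (h : ∀ i, V i (Real.exp (-δ i)) = p) (hs : ∑ i, δ i = t)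
    (h' : ∀ i, V i (Real.exp (-δ' i)) = p') (hs' : ∑ i, δ' i = t) : δ = δ' ∧ p = p' := by
  have : Nonempty (Fin n) := ⟨⟨0, hn⟩⟩
  have key : ∀ {p p' : ℝ} {δ δ' : Fin n → ℝ}, (∀ i, V i (Real.exp (-δ i)) = p) →
      (∀ i, V i (Real.exp (-δ' i)) = p') → ∑ i, δ i = t → ∑ i, δ' i = t → p ≤ p' := by
    intro p p' δ δ' h h' hs hs'
    by_contra! hp
    have : ∀ i, δ i < δ' i := fun i => by
      have := hp
      rw [← h i, ← h' i, (V i).lt_iff_lt, Real.exp_lt_exp] at this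
      linarith
    have := Finset.sum_lt_sum_of_nonempty Finset.univ_nonempty fun i _ => this i
    linarith
  have hp : p = p' := le_antisymm (key h h' hs hs') (key h' h hs' hs)
  refine ⟨funext fun i => ?_, hp⟩
  have := (V i).injective ((h i).trans (hp.trans (h' i).symm))
  simpa using this

/-- The continuous function `∏ V_i⁻¹(s)` runs from `0` at the largest of the lowest scores to `1` at
`b`, hence takes the value `e^{-t}`. -/
theorem exists_system_solution (hn : 0 < n) (hV : ∀ i, V i 1 = b) {t : ℝ} (ht : 0 ≤ t) :
    ∃ (δ : Fin n → ℝ) (p : ℝ),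
      (∀ i, 0 ≤ δ i) ∧ (∀ i, V i (Real.exp (-δ i)) = p) ∧ ∑ i, δ i = t := by
  have : Nonempty (Fin n) := ⟨⟨0, hn⟩⟩
  -- At `s = V k 0` the factor of `k` vanishes, and from there on all factors are nonnegative.
  obtain ⟨k, hk⟩ := Finite.exists_max fun i => V i 0
  have hkb : V k 0 ≤ b := by rw [← hV k]; exact (V k).monotone zero_le_one
  have hW1 : ∀ i, (V i).symm b = 1 := fun i => by rw [← hV i, (V i).symm_apply_apply]
  have hcont : Continuous fun s => ∏ i, (V i).symm s :=
    continuous_finsetProd _ fun i _ => (V i).symm.continuous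
  have hmem : Real.exp (-t) ∈ Icc (∏ i, (V i).symm (V k 0)) (∏ i, (V i).symm b) := by
    rw [Finset.prod_eq_zero (Finset.mem_univ k) (by simp), Finset.prod_eq_one fun i _ => hW1 i]
    exact ⟨(Real.exp_pos _).le, Real.exp_le_one_iff.2 (by linarith)⟩
  obtain ⟨p, hp, hpt⟩ := intermediate_value_Icc hkb hcont.continuousOn hmem
  simp only at hpt
  have hpos : ∀ i, 0 < (V i).symm p := fun i => by
    refine lt_of_le_of_ne ?_ fun h0 => ?_
    · rw [(V i).le_symm_apply]; exact (hk i).trans hp.1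
    · rw [Finset.prod_eq_zero (Finset.mem_univ i) h0.symm] at hpt
      exact (Real.exp_pos _).ne hpt
  have hle : ∀ i, (V i).symm p ≤ 1 := fun i => by rw [← hW1 i]; exact (V i).symm.monotone hp.2
  refine ⟨fun i => -Real.log ((V i).symm p), p, fun i => ?_, fun i => ?_, ?_⟩
  · exact neg_nonneg.2 (Real.log_nonpos (hpos i).le (hle i))
  · rw [neg_neg, Real.exp_log (hpos i), (V i).apply_symm_apply]
  · rw [Finset.sum_neg_distrib, ← Real.log_prod fun i _ => (hpos i).ne', hpt, Real.log_exp, neg_neg]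

end System

/-! ### The score reduced form and its winning regions -/

/-- The reduced form induced by the allocation to the highest nonnegative score, for scores that
extend to order isomorphisms of the line. -/
noncomputable def scoreReducedForm {n : ℕ} (V : Fin n → ℝ ≃o ℝ) (i : Fin n) (u : ℝ) : ℝ :=
  if 0 ≤ V i u then ∏ j ∈ Finset.univ.erase i, max 0 ((V j).symm (V i u)) else 0

/-- The quantile profiles at which bidder `i` has a quantile above `u` and wins. -/
def winSet {n : ℕ} (V : Fin n → ℝ ≃o ℝ) (i : Fin n) (u : ℝ) : Set (Fin n → ℝ) :=
  {w | w ∈ Icc (0 : Fin n → ℝ) 1 ∧ u < w i ∧ (∀ j, j ≠ i → V j (w j) < V i (w i)) ∧ 0 ≤ V i (w i)}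

section

variable {n : ℕ} {V : Fin n → ℝ ≃o ℝ} {b : ℝ}

theorem symm_le_one (hV : ∀ i, V i 1 = b) (i : Fin n) {s : ℝ} (hs : s ≤ b) : (V i).symm s ≤ 1 := by
  rw [(V i).symm_apply_le, hV]; exact hs

theorem score_le (hV : ∀ i, V i 1 = b) (i : Fin n) {u : ℝ} (hu : u ≤ 1) : V i u ≤ b := by
  rw [← hV i]; exact (V i).monotone hu

theorem scoreReducedForm_nonneg (i : Fin n) (u : ℝ) : 0 ≤ scoreReducedForm V i u := by
  unfold scoreReducedForm
  split_ifs
  · exact Finset.prod_nonneg fun _ _ => le_max_left _ _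
  · exact le_rfl

theorem monotone_scoreReducedForm (i : Fin n) : Monotone (scoreReducedForm V i) := by
  intro u w huw
  have hle := (V i).monotone huw
  by_cases hu : 0 ≤ V i u
  · simp only [scoreReducedForm, if_pos hu, if_pos (hu.trans hle)]
    exact Finset.prod_le_prod (fun _ _ => le_max_left _ _) fun j _ =>
      max_le_max le_rfl ((V j).symm.monotone hle)
  · rw [scoreReducedForm, if_neg hu]
    exact scoreReducedForm_nonneg i w

theorem continuous_scoreProduct (i : Fin n) :
    Continuous fun u => ∏ j ∈ Finset.univ.erase i, max 0 ((V j).symm (V i u)) :=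
  continuous_finsetProd _ fun j _ =>
    continuous_const.max ((V j).symm.continuous.comp (V i).continuous)

theorem continuousWithinAt_scoreReducedForm (i : Fin n) (u : ℝ) :
    ContinuousWithinAt (scoreReducedForm V i) (Ici u) u := by
  by_cases hu : 0 ≤ V i u
  · refine (continuous_scoreProduct (V := V) i).continuousWithinAt.congr (fun w hw => ?_) ?_
    · exact if_pos (hu.trans ((V i).monotone hw))
    · exact if_pos hu
  · refine ContinuousAt.continuousWithinAt ?_
    have : ∀ᶠ w in nhds u, V i w < 0 :=
      (V i).continuous.continuousAt.eventually (Iio_mem_nhds (not_le.1 hu))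
    refine (continuousAt_const (y := (0 : ℝ))).congr ?_
    filter_upwards [this] with w hw
    exact (if_neg (not_le.2 hw)).symm

theorem isUnitCDF_scoreReducedForm (hV : ∀ i, V i 1 = b) (hb : 0 ≤ b) (i : Fin n) :
    IsUnitCDF (scoreReducedForm V i) where
  nonneg u _ := scoreReducedForm_nonneg i u
  mono := (monotone_scoreReducedForm i).monotoneOn _
  right_cont u _ := (continuousWithinAt_scoreReducedForm i u).mono Icc_subset_Ici_self
  one := by
    rw [scoreReducedForm, hV, if_pos hb]
    refine Finset.prod_eq_one fun j _ => ?_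
    rw [← hV j, (V j).symm_apply_apply]
    simp

theorem IsUnitCDF.intervalIntegrable {x : ℝ → ℝ} (hx : IsUnitCDF x) {s t : ℝ}
    (hs : s ∈ Icc (0 : ℝ) 1) (ht : t ∈ Icc (0 : ℝ) 1) : IntervalIntegrable x volume s t :=
  (hx.mono.mono (uIcc_subset_Icc hs ht)).intervalIntegrable

theorem measurableSet_winSet (i : Fin n) (u : ℝ) : MeasurableSet (winSet V i u) := by
  have hm : ∀ j, Measurable fun w : Fin n → ℝ => V j (w j) := fun j =>
    ((V j).continuous.comp (continuous_apply j)).measurable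
  have h2 : MeasurableSet {w : Fin n → ℝ | ∀ j, j ≠ i → V j (w j) < V i (w i)} := by
    simp only [ofPred_forall]
    exact MeasurableSet.iInter fun j => MeasurableSet.iInter fun _ => measurableSet_lt (hm j) (hm i)
  exact measurableSet_Icc.inter ((measurableSet_lt measurable_const (measurable_pi_apply i)).inter
    (h2.inter (measurableSet_le measurable_const (hm i))))

/-- Fubini in coordinate `i`: the slice at `w i = a` is the box of rival quantiles with scores below
`V i a`, whose volume is the winning probability. -/
theorem volume_winSet (hV : ∀ i, V i 1 = b) (hb : 0 ≤ b) (i : Fin n) {u : ℝ}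
    (hu : u ∈ Icc (0 : ℝ) 1) :
    volume (winSet V i u) = ENNReal.ofReal (∫ w in u..1, scoreReducedForm V i w) := by
  obtain _ | m := n
  · exact i.elim0
  have hmp := (volume_preserving_piFinSuccAbove (fun _ : Fin (m + 1) => ℝ) i).symm
  rw [← hmp.measure_preimage (measurableSet_winSet i u).nullMeasurableSet,
    Measure.volume_eq_prod,
    Measure.prod_apply ((MeasurableEquiv.measurable _) (measurableSet_winSet i u)),
    intervalIntegral.integral_of_le hu.2,
    ofReal_integral_eq_lintegral_ofReal
      (((isUnitCDF_scoreReducedForm hV hb i).intervalIntegrable hu ⟨zero_le_one, le_rfl⟩).1)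
      (Filter.Eventually.of_forall fun w => scoreReducedForm_nonneg i w),
    ← lintegral_indicator measurableSet_Ioc]
  refine lintegral_congr fun a => ?_
  have hpre : ∀ z : Fin m → ℝ, (z ∈ Prod.mk a ⁻¹'
      ((MeasurableEquiv.piFinSuccAbove (fun _ : Fin (m + 1) => ℝ) i).symm ⁻¹' winSet V i u)) ↔
      (0 ≤ a ∧ a ≤ 1 ∧ ∀ k, 0 ≤ z k ∧ z k ≤ 1) ∧ u < a ∧
        (∀ k, V (i.succAbove k) (z k) < V i a) ∧ 0 ≤ V i a := by
    intro z
    have hi : (MeasurableEquiv.piFinSuccAbove (fun _ : Fin (m + 1) => ℝ) i).symm (a, z) =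
      i.insertNth a z := rfl
    rw [mem_preimage, mem_preimage, hi]
    simp only [winSet, mem_ofPred_eq, mem_Icc, Pi.le_def, Fin.forall_iff_succAbove i,
      Fin.insertNth_apply_same, Fin.insertNth_apply_succAbove, Pi.zero_apply, Pi.one_apply,
      ne_eq, not_true_eq_false, false_imp_iff, true_and, Fin.succAbove_ne, not_false_eq_true,
      true_imp_iff]
    constructor
    · rintro ⟨⟨⟨h1, h2⟩, h3, h4⟩, h5⟩
      exact ⟨⟨h1, h3, fun k => ⟨h2 k, h4 k⟩⟩, h5⟩
    · rintro ⟨⟨h1, h3, h⟩, h5⟩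
      exact ⟨⟨⟨h1, fun k => (h k).1⟩, h3, fun k => (h k).2⟩, h5⟩
  by_cases ha : a ∈ Ioc u 1
  · rw [indicator_of_mem ha]
    by_cases h0 : 0 ≤ V i a
    · have hset : Prod.mk a ⁻¹'
          ((MeasurableEquiv.piFinSuccAbove (fun _ : Fin (m + 1) => ℝ) i).symm ⁻¹' winSet V i u) =
          Set.pi univ fun k => Ico 0 ((V (i.succAbove k)).symm (V i a)) := by
        ext z
        rw [hpre]
        simp only [mem_pi, mem_univ, true_imp_iff, mem_Ico, (V _).lt_symm_apply]
        constructor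
        · rintro ⟨⟨_, _, h⟩, _, h', _⟩ k
          exact ⟨(h k).1, h' k⟩
        · intro h
          refine ⟨⟨hu.1.trans ha.1.le, ha.2, fun k => ⟨(h k).1, ?_⟩⟩, ha.1, fun k => (h k).2, h0⟩
          have := (h k).2.trans_le (score_le hV i ha.2)
          rw [← hV (i.succAbove k), (V _).lt_iff_lt] at this
          exact this.le
      rw [hset, volume_pi_pi, scoreReducedForm, if_pos h0,
        ENNReal.ofReal_prod_of_nonneg fun _ _ => le_max_left _ _]
      have : Finset.univ.erase i = Finset.univ.map (i.succAboveEmb) := by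
        ext j
        simp [Fin.exists_succAbove_eq_iff]
      rw [this, Finset.prod_map]
      refine Finset.prod_congr rfl fun k _ => ?_
      rw [Real.volume_Ico, sub_zero]
      simp
    · rw [scoreReducedForm, if_neg h0, ENNReal.ofReal_zero]
      convert measure_empty (μ := (volume : Measure (Fin m → ℝ)))
      refine eq_empty_of_forall_notMem fun z hz => ?_
      exact h0 ((hpre z).1 hz).2.2.2
  · rw [indicator_of_notMem ha]
    convert measure_empty (μ := (volume : Measure (Fin m → ℝ)))
    refine eq_empty_of_forall_notMem fun z hz => ?_
    exact ha ⟨((hpre z).1 hz).2.1, ((hpre z).1 hz).1.2.1⟩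

/-- Once `w i` is fixed, injectivity of `V j` confines a tie to a hyperplane. -/
theorem volume_tie (i j : Fin n) (hij : j ≠ i) :
    volume {w : Fin n → ℝ | V j (w j) = V i (w i)} = 0 := by
  obtain _ | m := n
  · exact i.elim0
  have hm : ∀ j, Measurable fun w : Fin (m + 1) → ℝ => V j (w j) := fun j =>
    ((V j).continuous.comp (continuous_apply j)).measurable
  have hms : MeasurableSet {w : Fin (m + 1) → ℝ | V j (w j) = V i (w i)} :=
    measurableSet_eq_fun (hm j) (hm i)
  have hmp := (volume_preserving_piFinSuccAbove (fun _ : Fin (m + 1) => ℝ) i).symm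
  obtain ⟨k, rfl⟩ := Fin.exists_succAbove_eq hij
  rw [← hmp.measure_preimage hms.nullMeasurableSet, Measure.volume_eq_prod,
    Measure.prod_apply ((MeasurableEquiv.measurable _) hms), lintegral_eq_zero_iff']
  · refine Filter.Eventually.of_forall fun a => ?_
    have : Prod.mk a ⁻¹' ((MeasurableEquiv.piFinSuccAbove (fun _ : Fin (m + 1) => ℝ) i).symm ⁻¹'
        {w | V (i.succAbove k) (w (i.succAbove k)) = V i (w i)}) =
        {z : Fin m → ℝ | z k = (V (i.succAbove k)).symm (V i a)} := by
      ext z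
      have hi : (MeasurableEquiv.piFinSuccAbove (fun _ : Fin (m + 1) => ℝ) i).symm (a, z) =
        i.insertNth a z := rfl
      rw [mem_preimage, mem_preimage, hi]
      simp only [mem_ofPred_eq, Fin.insertNth_apply_same, Fin.insertNth_apply_succAbove]
      rw [eq_comm (a := z k), (V _).symm_apply_eq, eq_comm]
    simp only [this, Pi.zero_apply]
    exact Measure.pi_hyperplane _ k _
  · exact (measurable_measure_prodMk_left ((MeasurableEquiv.measurable _) hms)).aemeasurable

theorem pairwise_disjoint_winSet (u : Fin n → ℝ) :
    Pairwise (Function.onFun Disjoint fun i => winSet V i (u i)) := by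
  intro i j hij
  refine Set.disjoint_left.2 fun w hi hj => ?_
  exact lt_asymm (hi.2.2.1 j hij.symm) (hj.2.2.1 i hij)

theorem volume_iUnion_winSet (hV : ∀ i, V i 1 = b) (hb : 0 ≤ b) {u : Fin n → ℝ}
    (hu : ∀ i, u i ∈ Icc (0 : ℝ) 1) :
    volume (⋃ i, winSet V i (u i)) =
      ENNReal.ofReal (∑ i, ∫ w in (u i)..1, scoreReducedForm V i w) := by
  rw [measure_iUnion (pairwise_disjoint_winSet u) fun i => measurableSet_winSet i _, tsum_fintype,
    ENNReal.ofReal_sum_of_nonneg fun i _ => intervalIntegral.integral_nonneg (hu i).2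
      fun w _ => scoreReducedForm_nonneg i w]
  exact Finset.sum_congr rfl fun i _ => volume_winSet hV hb i (hu i)

theorem volume_unit_cube : volume (Icc (0 : Fin n → ℝ) 1) = 1 := by
  simp [Real.volume_Icc_pi]

theorem volume_subcube {u : Fin n → ℝ} (hu : ∀ i, u i ∈ Icc (0 : ℝ) 1) :
    volume (Icc (0 : Fin n → ℝ) u) = ENNReal.ofReal (∏ i, u i) := by
  rw [Real.volume_Icc_pi, ENNReal.ofReal_prod_of_nonneg fun i _ => (hu i).1]
  simp

theorem winSet_subset (u : Fin n → ℝ) (i : Fin n) :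
    winSet V i (u i) ⊆ Icc (0 : Fin n → ℝ) 1 \ Icc 0 u := fun _ hw =>
  ⟨hw.1, fun h => hw.2.1.not_ge (h.2 i)⟩

theorem volume_cube_diff {u : Fin n → ℝ} (hu : ∀ i, u i ∈ Icc (0 : ℝ) 1) :
    volume (Icc (0 : Fin n → ℝ) 1 \ Icc 0 u) = ENNReal.ofReal (1 - ∏ i, u i) := by
  rw [measure_sdiff (Icc_subset_Icc le_rfl fun i => (hu i).2) measurableSet_Icc.nullMeasurableSet
    (by rw [volume_subcube hu]; exact ENNReal.ofReal_ne_top), volume_unit_cube, volume_subcube hu,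
    ENNReal.ofReal_sub _ (Finset.prod_nonneg fun i _ => (hu i).1), ENNReal.ofReal_one]

/-- The winning regions are disjoint and miss the box `[0,u]`, so their total volume is at most `1 -
∏ u i`. -/
theorem border_scoreReducedForm_le (hV : ∀ i, V i 1 = b) (hb : 0 ≤ b) {u : Fin n → ℝ}
    (hu : ∀ i, u i ∈ Icc (0 : ℝ) 1) : border (scoreReducedForm V) u ≤ 1 := by
  have hle := measure_mono (μ := volume) (iUnion_subset fun i => winSet_subset (V := V) u i)
  rw [volume_iUnion_winSet hV hb hu, volume_cube_diff hu, ENNReal.ofReal_le_ofReal_iff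
    (sub_nonneg.2 (Finset.prod_le_one (fun i _ => (hu i).1) fun i _ => (hu i).2))] at hle
  simp only [border]
  linarith

/-- Outside the box some score exceeds `s ≥ 0`, so the highest score is nonnegative and its bidder
wins unless there is a tie: the winning regions fill the complement up to a null set. -/
theorem border_scoreReducedForm_eq (hV : ∀ i, V i 1 = b) {s : ℝ} (hs0 : 0 ≤ s) (hsb : s ≤ b) :
    border (scoreReducedForm V) (fun i => max 0 ((V i).symm s)) = 1 := by
  have hb : 0 ≤ b := hs0.trans hsb
  have hu : ∀ i, max 0 ((V i).symm s) ∈ Icc (0 : ℝ) 1 := fun i =>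
    ⟨le_max_left _ _, max_le zero_le_one (symm_le_one hV i hsb)⟩
  -- The faces `w i = 0` are excluded because `winSet` asks for a quantile strictly above the
  -- cutoff, which may have been truncated to `0`.
  have hsub : Icc (0 : Fin n → ℝ) 1 \ Icc 0 (fun i => max 0 ((V i).symm s)) ⊆
      (⋃ i, winSet V i (max 0 ((V i).symm s))) ∪
        ((⋃ i, ⋃ j, ⋃ (_ : j ≠ i), {w : Fin n → ℝ | V j (w j) = V i (w i)}) ∪
          ⋃ i, {w : Fin n → ℝ | w i = 0}) := by
    rintro w ⟨hw, hw'⟩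
    by_contra hcon
    simp only [mem_union, mem_iUnion, mem_ofPred_eq, not_or, not_exists] at hcon
    obtain ⟨hwin, htie, hzero⟩ := hcon
    have : ∃ i, max 0 ((V i).symm s) < w i := by
      by_contra! h
      exact hw' ⟨hw.1, h⟩
    obtain ⟨i, hi⟩ := this
    have : Nonempty (Fin n) := ⟨i⟩
    obtain ⟨k, hk⟩ := Finite.exists_max fun j => V j (w j)
    have hsi : s < V i (w i) := by
      rw [← (V i).symm_apply_lt]; exact (le_max_right _ _).trans_lt hi
    have hsk := hsi.trans_le (hk i)
    refine hwin k ⟨hw, max_lt ((hw.1 k).lt_of_ne' (hzero k)) ?_, fun j hj =>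
      (hk j).lt_of_ne (htie k j hj), hs0.trans hsk.le⟩
    rwa [(V k).symm_apply_lt]
  have hnull : volume ((⋃ i, ⋃ j, ⋃ (_ : j ≠ i), {w : Fin n → ℝ | V j (w j) = V i (w i)}) ∪
      ⋃ i, {w : Fin n → ℝ | w i = 0}) = 0 := by
    refine measure_union_null ?_ ?_
    · exact measure_iUnion_null fun i => measure_iUnion_null fun j => measure_iUnion_null fun h =>
        volume_tie i j h
    · exact measure_iUnion_null fun i => Measure.pi_hyperplane _ i 0
  have hle := (measure_mono (μ := volume) hsub).trans (measure_union_le _ _)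
  rw [hnull, add_zero, volume_iUnion_winSet hV hb hu, volume_cube_diff hu,
    ENNReal.ofReal_le_ofReal_iff (Finset.sum_nonneg fun i _ =>
      intervalIntegral.integral_nonneg (hu i).2 fun w _ => scoreReducedForm_nonneg i w)] at hle
  refine le_antisymm (border_scoreReducedForm_le hV hb hu) ?_
  simp only [border]
  linarith

/-! ### The score allocation induces the score reduced form -/

theorem isAllocation_scoreAllocation (q : Fin n → ℝ → ℝ) : IsAllocation (scoreAllocation q) := by
  refine fun u _ => ⟨fun i => ?_, ?_⟩
  · unfold scoreAllocation
    split_ifs <;> simp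
  · by_cases h : ∃ i, (∀ j, j ≠ i → q j (u j) < q i (u i)) ∧ 0 ≤ q i (u i)
    · obtain ⟨i, hi⟩ := h
      rw [Finset.sum_eq_single i]
      · exact (if_pos hi).le
      · intro j _ hj
        exact if_neg fun h => lt_asymm (h.1 i hj.symm) (hi.1 j hj)
      · simp
    · push Not at h
      refine (Finset.sum_eq_zero fun i _ => if_neg ?_).trans_le zero_le_one
      exact fun hi => (h i hi.1).not_ge hi.2

theorem induces_scoreAllocation {q : Fin n → ℝ → ℝ} (hq : ∀ i, EqOn (q i) (V i) (Icc 0 1))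
    (hV : ∀ i, V i 1 = b) : Induces (scoreAllocation q) (scoreReducedForm V) := by
  refine ⟨isAllocation_scoreAllocation q, fun i u hu => ?_⟩
  -- The box of profiles at which all rivals score below `V i u`; coordinate `i` is overwritten by
  -- `u`, hence free, and contributes a factor `1`.
  let S : Set (Fin n → ℝ) := Set.pi univ fun j => if j = i then Icc 0 1 else
    Ico 0 ((V j).symm (V i u))
  have hSm : MeasurableSet S := MeasurableSet.univ_pi fun j => by
    split_ifs
    exacts [measurableSet_Icc, measurableSet_Ico]
  have hSsub : S ⊆ Icc 0 1 := by
    intro w hw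
    have h : ∀ j, w j ∈ Icc (0 : ℝ) 1 := fun j => by
      have := hw j (mem_univ j)
      dsimp only at this
      split_ifs at this with hj
      · exact this
      · exact ⟨this.1, this.2.le.trans (symm_le_one hV j (score_le hV i hu.2))⟩
    exact ⟨fun j => (h j).1, fun j => (h j).2⟩
  have heq : EqOn (fun w : Fin n → ℝ => scoreAllocation q (Function.update w i u) i)
      (S.indicator fun _ => if 0 ≤ V i u then 1 else 0) (Icc 0 1) := by
    intro w hw
    have hmem : w ∈ S ↔ ∀ j, j ≠ i → q j (Function.update w i u j) < V i u := by
      simp only [S, mem_pi, mem_univ, true_imp_iff]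
      refine forall_congr' fun j => ?_
      have hwj : w j ∈ Icc (0 : ℝ) 1 := ⟨hw.1 j, hw.2 j⟩
      by_cases hj : j = i
      · subst hj; simpa using hwj
      · rw [if_neg hj, Function.update_of_ne hj, hq j hwj, mem_Ico, (V j).lt_symm_apply]
        exact ⟨fun h _ => h.2, fun h => ⟨hwj.1, h hj⟩⟩
    simp only [scoreAllocation, Function.update_self, hq i hu]
    by_cases hS : w ∈ S
    · rw [indicator_of_mem hS]
      simp only [and_iff_right (hmem.1 hS)]
    · rw [indicator_of_notMem hS, if_neg fun h => hS (hmem.2 h.1)]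
  have hvol : volume.real S = ∏ j ∈ Finset.univ.erase i, max 0 ((V j).symm (V i u)) := by
    rw [Measure.real, volume_pi_pi, ENNReal.toReal_prod,
      ← Finset.mul_prod_erase _ _ (Finset.mem_univ i)]
    simp only [if_true, Real.volume_Icc, sub_zero, ENNReal.ofReal_one, ENNReal.toReal_one, one_mul]
    refine Finset.prod_congr rfl fun j hj => ?_
    rw [if_neg (Finset.ne_of_mem_erase hj), Real.volume_Ico, sub_zero, ENNReal.toReal_ofReal',
      max_comm]
  have hfin : volume (Icc (0 : Fin n → ℝ) 1) ≠ ⊤ := by rw [volume_unit_cube]; simp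
  refine ⟨(IntegrableOn.congr_fun ?_ heq.symm measurableSet_Icc), ?_⟩
  · exact (integrableOn_const hfin).indicator hSm
  · rw [setIntegral_congr_fun measurableSet_Icc heq, setIntegral_indicator hSm,
      inter_eq_right.2 hSsub, setIntegral_const, hvol, scoreReducedForm]
    split_ifs <;> simp

end

/-! ### Revenue as a bound minus penalties -/

section

variable {n : ℕ} {V : Fin n → ℝ ≃o ℝ} {b : ℝ}

/-- Layer-cake representation of the revenue from nonnegative scores. -/
theorem integral_posPart_score_mul {W : ℝ ≃o ℝ} (hW : W 1 = b) (hb : 0 ≤ b) {y : ℝ → ℝ}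
    (hy : IntervalIntegrable y volume 0 1) :
    ∫ u in (0 : ℝ)..1, max 0 (W u) * y u =
      ∫ s in (0 : ℝ)..b, ∫ u in (max 0 (W.symm s))..1, y u := by
  -- Since `W u ≤ b`, the positive part of `W u` is the length of `{s ∈ (0,b] | s < W u}`; the rest
  -- is Fubini.
  have hint : Integrable (Function.uncurry fun s u : ℝ => if s < W u then y u else 0)
      ((volume.restrict (Ioc 0 b)).prod (volume.restrict (Ioc (0 : ℝ) 1))) := by
    have h1 : Integrable (fun p : ℝ × ℝ => y p.2)
        ((volume.restrict (Ioc 0 b)).prod (volume.restrict (Ioc (0 : ℝ) 1))) :=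
      Integrable.comp_snd hy.1 _
    have hm : MeasurableSet {p : ℝ × ℝ | p.1 < W p.2} :=
      measurableSet_lt measurable_fst (W.continuous.measurable.comp measurable_snd)
    refine (h1.indicator hm).congr (Filter.Eventually.of_forall fun p => ?_)
    simp only [indicator, mem_ofPred_eq, Function.uncurry]
  have hswap := integral_integral_swap hint
  rw [intervalIntegral.integral_of_le zero_le_one, intervalIntegral.integral_of_le hb]
  have hleft : ∫ s in Ioc 0 b, ∫ u in (max 0 (W.symm s))..1, y u =
      ∫ s in Ioc 0 b, ∫ u in Ioc (0 : ℝ) 1, if s < W u then y u else 0 := by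
    refine setIntegral_congr_fun measurableSet_Ioc fun s hs => ?_
    have h1 : max 0 (W.symm s) ≤ 1 := by
      refine max_le zero_le_one ?_
      rw [W.symm_apply_le, hW]; exact hs.2
    have hset : Ioc (0 : ℝ) 1 ∩ Ioi (W.symm s) = Ioc (max 0 (W.symm s)) 1 := by
      ext u; simp only [mem_inter_iff, mem_Ioc, mem_Ioi, max_lt_iff]; tauto
    rw [intervalIntegral.integral_of_le h1, ← hset, ← setIntegral_indicator measurableSet_Ioi]
    refine integral_congr_ae (Filter.Eventually.of_forall fun u => ?_)
    simp only [indicator, mem_Ioi, W.symm_apply_lt]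
  have hright : ∫ u in Ioc (0 : ℝ) 1, max 0 (W u) * y u =
      ∫ u in Ioc (0 : ℝ) 1, ∫ s in Ioc 0 b, if s < W u then y u else 0 := by
    refine setIntegral_congr_fun measurableSet_Ioc fun u hu => ?_
    have hWu : W u ≤ b := hW ▸ W.monotone hu.2
    have hset : Ioc 0 b ∩ Iio (W u) = Ioo 0 (W u) := by
      ext s; simp only [mem_inter_iff, mem_Ioc, mem_Iio, mem_Ioo]
      exact ⟨fun h => ⟨h.1.1, h.2⟩, fun h => ⟨⟨h.1, h.2.le.trans hWu⟩, h.2⟩⟩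
    have : ∀ s, (if s < W u then y u else 0) = (Iio (W u)).indicator (fun _ => y u) s := fun s => by
      simp only [indicator, mem_Iio]
    simp only [this]
    rw [setIntegral_indicator measurableSet_Iio, hset, setIntegral_const, measureReal_def,
      Real.volume_Ioo, sub_zero, ENNReal.toReal_ofReal', max_comm, smul_eq_mul]
  rw [hleft, hright, hswap]

theorem continuousOn_upperIntegral (hV : ∀ i, V i 1 = b) {y : ℝ → ℝ} (hy : IsUnitCDF y)
    (i : Fin n) :
    ContinuousOn (fun s => ∫ u in (max 0 ((V i).symm s))..1, y u) (Icc 0 b) := by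
  have h := intervalIntegral.continuousOn_primitive_interval_left (μ := volume) (a := (0 : ℝ))
    (b := 1) (f := y) (by
      rw [uIcc_of_le zero_le_one, integrableOn_Icc_iff_integrableOn_Ioc]
      exact (hy.intervalIntegrable ⟨le_rfl, zero_le_one⟩ ⟨zero_le_one, le_rfl⟩).1)
  rw [uIcc_of_le zero_le_one] at h
  exact h.comp (continuous_const.max (V i).symm.continuous).continuousOn fun s hs =>
    ⟨le_max_left _ _, max_le zero_le_one (symm_le_one hV i hs.2)⟩

theorem continuousOn_border (hV : ∀ i, V i 1 = b) {y : Fin n → ℝ → ℝ}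
    (hy : ∀ i, IsUnitCDF (y i)) :
    ContinuousOn (fun s => border y fun i => max 0 ((V i).symm s)) (Icc 0 b) := by
  refine ContinuousOn.add (Continuous.continuousOn ?_)
    (continuousOn_finsetSum _ fun i _ => continuousOn_upperIntegral hV (hy i) i)
  exact continuous_finsetProd _ fun i _ => continuous_const.max (V i).symm.continuous

/-- Revenue in terms of the slack in Border's constraints along the path of score level sets. -/
theorem sum_integral_score_mul (hV : ∀ i, V i 1 = b) (hb : 0 ≤ b) {y : Fin n → ℝ → ℝ}
    (hy : ∀ i, IsUnitCDF (y i)) :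
    ∑ i, ∫ u in (0 : ℝ)..1, V i u * y i u =
      (∫ s in (0 : ℝ)..b, (1 - ∏ i, max 0 ((V i).symm s)))
      - (∫ s in (0 : ℝ)..b, (1 - border y fun i => max 0 ((V i).symm s)))
      - ∑ i, ∫ u in (0 : ℝ)..1, max 0 (-V i u) * y i u := by
  have hyi : ∀ i, IntervalIntegrable (y i) volume 0 1 := fun i =>
    (hy i).intervalIntegrable ⟨le_rfl, zero_le_one⟩ ⟨zero_le_one, le_rfl⟩
  have hsplit : ∀ i, ∫ u in (0 : ℝ)..1, V i u * y i u =
      (∫ u in (0 : ℝ)..1, max 0 (V i u) * y i u) - ∫ u in (0 : ℝ)..1, max 0 (-V i u) * y i u := by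
    intro i
    have hp : IntervalIntegrable (fun u => max 0 (V i u) * y i u) volume 0 1 :=
      (hyi i).continuousOn_mul (continuous_const.max (V i).continuous).continuousOn
    have hm : IntervalIntegrable (fun u => max 0 (-V i u) * y i u) volume 0 1 :=
      (hyi i).continuousOn_mul
        (continuous_const.max (continuous_neg.comp (V i).continuous)).continuousOn
    rw [← intervalIntegral.integral_sub hp hm]
    refine intervalIntegral.integral_congr fun u _ => ?_
    rw [← sub_mul]
    congr 1
    rcases max_cases 0 (V i u) with h | h <;> rcases max_cases 0 (-V i u) with h' | h' <;> linarith
  have hprod : IntervalIntegrable (fun s => 1 - ∏ i, max 0 ((V i).symm s)) volume 0 b :=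
    (continuous_const.sub (continuous_finsetProd _ fun i _ =>
      continuous_const.max (V i).symm.continuous)).intervalIntegrable _ _
  have hbor : IntervalIntegrable (fun s => 1 - border y fun i => max 0 ((V i).symm s))
      volume 0 b := by
    refine ContinuousOn.intervalIntegrable ?_
    rw [uIcc_of_le hb]
    exact continuousOn_const.sub (continuousOn_border hV hy)
  rw [Finset.sum_congr rfl fun i _ => hsplit i, Finset.sum_sub_distrib,
    Finset.sum_congr rfl fun i _ => integral_posPart_score_mul (hV i) hb (hyi i),
    ← intervalIntegral.integral_finsetSum, ← intervalIntegral.integral_sub hprod hbor]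
  · congr 1
    refine intervalIntegral.integral_congr fun s _ => ?_
    simp only [border]
    ring
  · intro i _
    refine ContinuousOn.intervalIntegrable ?_
    rw [uIcc_of_le hb]
    exact continuousOn_upperIntegral hV (hy i) i

theorem IsFeasibleReducedForm.slack_nonneg (hV : ∀ i, V i 1 = b) {y : Fin n → ℝ → ℝ}
    (hy : IsFeasibleReducedForm y) {s : ℝ} (hs : s ≤ b) :
    0 ≤ 1 - border y fun i => max 0 ((V i).symm s) :=
  sub_nonneg.2 (hy.2 _ fun i => ⟨le_max_left _ _, max_le zero_le_one (symm_le_one hV i hs)⟩)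

theorem integral_negPart_score_mul_nonneg {y : ℝ → ℝ} (hy : IsUnitCDF y) (W : ℝ ≃o ℝ) :
    0 ≤ ∫ u in (0 : ℝ)..1, max 0 (-W u) * y u :=
  intervalIntegral.integral_nonneg zero_le_one fun u hu =>
    mul_nonneg (le_max_left _ _) (hy.nonneg u hu)

theorem isFeasibleReducedForm_scoreReducedForm (hV : ∀ i, V i 1 = b) (hb : 0 ≤ b) :
    IsFeasibleReducedForm (scoreReducedForm V) :=
  ⟨isUnitCDF_scoreReducedForm hV hb, fun _ hu => border_scoreReducedForm_le hV hb hu⟩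

/-- Both penalties vanish: Border's constraint binds along the path, and negative scores are never
served. -/
theorem sum_integral_score_mul_scoreReducedForm (hV : ∀ i, V i 1 = b) (hb : 0 ≤ b) :
    ∑ i, ∫ u in (0 : ℝ)..1, V i u * scoreReducedForm V i u =
      ∫ s in (0 : ℝ)..b, (1 - ∏ i, max 0 ((V i).symm s)) := by
  rw [sum_integral_score_mul hV hb (isUnitCDF_scoreReducedForm hV hb)]
  have h1 : ∫ s in (0 : ℝ)..b, (1 - border (scoreReducedForm V) fun i => max 0 ((V i).symm s)) =
      0 := by
    rw [intervalIntegral.integral_congr (g := fun _ => 0), intervalIntegral.integral_zero]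
    intro s hs
    rw [uIcc_of_le hb] at hs
    simp only [border_scoreReducedForm_eq hV hs.1 hs.2, sub_self]
  have h2 : ∀ i, ∫ u in (0 : ℝ)..1, max 0 (-V i u) * scoreReducedForm V i u = 0 := by
    intro i
    rw [intervalIntegral.integral_congr (g := fun _ => 0), intervalIntegral.integral_zero]
    intro u _
    simp only [scoreReducedForm]
    split_ifs with h
    · rw [max_eq_left (neg_nonpos.2 h), zero_mul]
    · rw [mul_zero]
  simp [h1, h2]

theorem sum_integral_score_mul_le (hV : ∀ i, V i 1 = b) (hb : 0 ≤ b) {y : Fin n → ℝ → ℝ}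
    (hy : IsFeasibleReducedForm y) :
    ∑ i, ∫ u in (0 : ℝ)..1, V i u * y i u ≤
      ∑ i, ∫ u in (0 : ℝ)..1, V i u * scoreReducedForm V i u := by
  rw [sum_integral_score_mul_scoreReducedForm hV hb, sum_integral_score_mul hV hb hy.1]
  have h1 : 0 ≤ ∫ s in (0 : ℝ)..b, (1 - border y fun i => max 0 ((V i).symm s)) :=
    intervalIntegral.integral_nonneg hb fun s hs => hy.slack_nonneg hV hs.2
  have h2 : 0 ≤ ∑ i, ∫ u in (0 : ℝ)..1, max 0 (-V i u) * y i u :=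
    Finset.sum_nonneg fun i _ => integral_negPart_score_mul_nonneg (hy.1 i) (V i)
  linarith

/-! ### Uniqueness from binding constraints -/

/-- Moving one coordinate away from a point where Border's constraint binds. -/
theorem IsFeasibleReducedForm.mul_prod_le {y : Fin n → ℝ → ℝ} (hy : IsFeasibleReducedForm y)
    {g : Fin n → ℝ} (hg : ∀ i, g i ∈ Icc (0 : ℝ) 1) (hg1 : border y g = 1) (i : Fin n) {w : ℝ}
    (hw : w ∈ Icc (0 : ℝ) 1) :
    (w - g i) * ∏ j ∈ Finset.univ.erase i, g j ≤ ∫ u in (g i)..w, y i u := by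
  have h1 : (1 : ℝ) ∈ Icc (0 : ℝ) 1 := ⟨zero_le_one, le_rfl⟩
  have h := hy.2 (Function.update g i w) fun j => by
    by_cases hj : j = i
    · subst hj; simpa using hw
    · simpa [hj] using hg j
  rw [← hg1] at h
  simp only [border] at h
  rw [← Finset.mul_prod_erase _ _ (Finset.mem_univ i),
    ← Finset.mul_prod_erase _ g (Finset.mem_univ i),
    ← Finset.add_sum_erase _ _ (Finset.mem_univ i),
    ← Finset.add_sum_erase _ (fun j => ∫ u in (g j)..1, y j u) (Finset.mem_univ i),
    Function.update_self,
    Finset.prod_congr rfl fun j hj => Function.update_of_ne (Finset.ne_of_mem_erase hj) w g,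
    Finset.sum_congr rfl fun j hj => by
      rw [Function.update_of_ne (Finset.ne_of_mem_erase hj) w g]] at h
  have hadd := intervalIntegral.integral_add_adjacent_intervals
    ((hy.1 i).intervalIntegrable (hg i) hw) ((hy.1 i).intervalIntegrable hw h1)
  linarith

/-- Monotonicity bounds the integral in `mul_prod_le` by `(w - g i) * y i w`; divide by `w - g i >
0`. Below `g i` the sign of that factor flips and gives the reverse bound `apply_le_prod`. -/
theorem IsFeasibleReducedForm.prod_le_apply {y : Fin n → ℝ → ℝ} (hy : IsFeasibleReducedForm y)
    {g : Fin n → ℝ} (hg : ∀ i, g i ∈ Icc (0 : ℝ) 1) (hg1 : border y g = 1) (i : Fin n) {w : ℝ}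
    (hw : w ≤ 1) (hgw : g i < w) : ∏ j ∈ Finset.univ.erase i, g j ≤ y i w := by
  have hwm : w ∈ Icc (0 : ℝ) 1 := ⟨(hg i).1.trans hgw.le, hw⟩
  have h := hy.mul_prod_le hg hg1 i hwm
  have h2 : ∫ u in (g i)..w, y i u ≤ ∫ _ in (g i)..w, y i w :=
    intervalIntegral.integral_mono_on hgw.le ((hy.1 i).intervalIntegrable (hg i) hwm)
      intervalIntegrable_const fun u hu =>
        (hy.1 i).mono ⟨(hg i).1.trans hu.1, hu.2.trans hw⟩ hwm hu.2
  rw [intervalIntegral.integral_const, smul_eq_mul] at h2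
  exact le_of_mul_le_mul_left (h.trans h2) (sub_pos.2 hgw)

theorem IsFeasibleReducedForm.apply_le_prod {y : Fin n → ℝ → ℝ} (hy : IsFeasibleReducedForm y)
    {g : Fin n → ℝ} (hg : ∀ i, g i ∈ Icc (0 : ℝ) 1) (hg1 : border y g = 1) (i : Fin n) {w : ℝ}
    (hw : 0 ≤ w) (hgw : w < g i) : y i w ≤ ∏ j ∈ Finset.univ.erase i, g j := by
  have hwm : w ∈ Icc (0 : ℝ) 1 := ⟨hw, hgw.le.trans (hg i).2⟩
  have h := hy.mul_prod_le hg hg1 i hwm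
  rw [intervalIntegral.integral_symm] at h
  have h2 : ∫ _ in w..(g i), y i w ≤ ∫ u in w..(g i), y i u :=
    intervalIntegral.integral_mono_on hgw.le intervalIntegrable_const
      ((hy.1 i).intervalIntegrable hwm (hg i)) fun u hu =>
        (hy.1 i).mono hwm ⟨hw.trans hu.1, hu.2.trans (hg i).2⟩ hu.1
  rw [intervalIntegral.integral_const, smul_eq_mul] at h2
  refine le_of_mul_le_mul_left ?_ (sub_pos.2 hgw)
  linarith

theorem IsUnitCDF.le_of_forall_gt {x : ℝ → ℝ} (hx : IsUnitCDF x) {u c : ℝ} (h0 : 0 ≤ u)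
    (h1 : u < 1) (h : ∀ w, u < w → w ≤ 1 → c ≤ x w) : c ≤ x u := by
  have hc : Filter.Tendsto x (nhdsWithin u (Ioc u 1)) (nhds (x u)) :=
    ((hx.right_cont u ⟨h0, h1.le⟩).mono Ioc_subset_Icc_self)
  rw [nhdsWithin_Ioc_eq_nhdsGT h1] at hc
  refine ge_of_tendsto hc ?_
  filter_upwards [Ioc_mem_nhdsGT h1] with w hw
  exact h w hw.1 hw.2

/-- The score reduced form is the only feasible one with maximal revenue. -/
theorem eqOn_scoreReducedForm (hV : ∀ i, V i 1 = b) (hb : 0 < b) {y : Fin n → ℝ → ℝ}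
    (hy : IsFeasibleReducedForm y)
    (hopt : ∑ i, ∫ u in (0 : ℝ)..1, V i u * scoreReducedForm V i u ≤
      ∑ i, ∫ u in (0 : ℝ)..1, V i u * y i u) (i : Fin n) :
    EqOn (y i) (scoreReducedForm V i) (Icc 0 1) := by
  rw [sum_integral_score_mul_scoreReducedForm hV hb.le, sum_integral_score_mul hV hb.le hy.1]
    at hopt
  have h1 : 0 ≤ ∫ s in (0 : ℝ)..b, (1 - border y fun i => max 0 ((V i).symm s)) :=
    intervalIntegral.integral_nonneg hb.le fun s hs => hy.slack_nonneg hV hs.2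
  have h2 : ∀ j ∈ Finset.univ, 0 ≤ ∫ u in (0 : ℝ)..1, max 0 (-V j u) * y j u :=
    fun j _ => integral_negPart_score_mul_nonneg (hy.1 j) (V j)
  have h2' := Finset.sum_nonneg h2
  have hneg : ∫ u in (0 : ℝ)..1, max 0 (-V i u) * y i u = 0 :=
    (Finset.sum_eq_zero_iff_of_nonneg h2).1 (by linarith) i (Finset.mem_univ i)
  -- The slack is continuous and nonnegative with integral zero, so it vanishes at every level, not
  -- only almost everywhere.
  have hbind : ∀ s ∈ Icc 0 b, border y (fun i => max 0 ((V i).symm s)) = 1 := by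
    intro s hs
    by_contra hne
    have hpos : 0 < 1 - border y fun i => max 0 ((V i).symm s) :=
      (hy.slack_nonneg hV hs.2).lt_of_ne fun h => hne (by linarith)
    have hcont : ContinuousOn (fun s => 1 - border y fun i => max 0 ((V i).symm s)) (Icc 0 b) :=
      continuousOn_const.sub (continuousOn_border hV hy.1)
    have := intervalIntegral.integral_pos hb hcont
      (fun s hs => hy.slack_nonneg hV hs.2) ⟨s, hs, hpos⟩
    linarith
  have hg : ∀ s ∈ Icc 0 b, ∀ j, max 0 ((V j).symm s) ∈ Icc (0 : ℝ) 1 := fun s hs j =>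
    ⟨le_max_left _ _, max_le zero_le_one (symm_le_one hV j hs.2)⟩
  intro u hu
  have hx := isUnitCDF_scoreReducedForm hV hb.le i
  rcases hu.2.eq_or_lt with rfl | hu1
  · rw [(hy.1 i).one, hx.one]
  by_cases h0 : 0 ≤ V i u
  · have hG : ∀ w, 0 ≤ w → max 0 ((V i).symm (V i w)) = w := fun w hw => by
      rw [(V i).symm_apply_apply, max_eq_right hw]
    refine le_antisymm (hx.le_of_forall_gt hu.1 hu1 fun w huw hw1 => ?_) ?_
    · have hs : V i w ∈ Icc 0 b := ⟨h0.trans ((V i).monotone huw.le), score_le hV i hw1⟩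
      rw [scoreReducedForm, if_pos hs.1]
      refine hy.apply_le_prod (hg _ hs) (hbind _ hs) i hu.1 ?_
      rwa [hG w (hu.1.trans huw.le)]
    · have hs : V i u ∈ Icc 0 b := ⟨h0, score_le hV i hu.2⟩
      refine (hy.1 i).le_of_forall_gt hu.1 hu1 fun w huw hw1 => ?_
      rw [scoreReducedForm, if_pos h0]
      refine hy.prod_le_apply (hg _ hs) (hbind _ hs) i hw1 ?_
      rwa [hG u hu.1]
  · rw [scoreReducedForm, if_neg h0]
    rw [not_le] at h0
    by_contra hne
    have hyu : 0 < y i u := ((hy.1 i).nonneg u hu).lt_of_ne' hne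
    -- Up to the point `m` where the score is half of `V i u`, the loss density is at least `-(V i u
    -- / 2) * y i u > 0`, contradicting `hneg`.
    set m := (V i).symm (V i u / 2) with hm
    have hum : u < m := by rw [hm, (V i).lt_symm_apply]; linarith
    have hm1 : m ≤ 1 := symm_le_one hV i (by linarith)
    have hmm : m ∈ Icc (0 : ℝ) 1 := ⟨hu.1.trans hum.le, hm1⟩
    have hfi : ∀ {s t : ℝ}, s ∈ Icc (0 : ℝ) 1 → t ∈ Icc (0 : ℝ) 1 →
        IntervalIntegrable (fun u => max 0 (-V i u) * y i u) volume s t := fun hs ht =>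
      ((hy.1 i).intervalIntegrable hs ht).continuousOn_mul
        (continuous_const.max (continuous_neg.comp (V i).continuous)).continuousOn
    have hle1 : ∫ w in u..m, max 0 (-V i w) * y i w ≤ ∫ w in (0 : ℝ)..1, max 0 (-V i w) * y i w := by
      refine intervalIntegral.integral_mono_interval hu.1 hum.le hm1 ?_
        (hfi ⟨le_rfl, zero_le_one⟩ ⟨zero_le_one, le_rfl⟩)
      filter_upwards [ae_restrict_mem measurableSet_Ioc] with w hw
      exact mul_nonneg (le_max_left _ _) ((hy.1 i).nonneg w ⟨hw.1.le, hw.2⟩)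
    have hle2 : ∫ _ in u..m, (-(V i u / 2)) * y i u ≤ ∫ w in u..m, max 0 (-V i w) * y i w := by
      refine intervalIntegral.integral_mono_on hum.le intervalIntegrable_const (hfi hu hmm)
        fun w hw => ?_
      have hVw : V i w ≤ V i u / 2 := by
        rw [← (V i).le_symm_apply]; exact hw.2
      exact mul_le_mul ((neg_le_neg hVw).trans (le_max_right _ _))
        ((hy.1 i).mono hu ⟨hu.1.trans hw.1, hw.2.trans hm1⟩ hw.1) hyu.le (le_max_left _ _)
    rw [intervalIntegral.integral_const, smul_eq_mul] at hle2
    have : 0 < (m - u) * (-(V i u / 2) * y i u) :=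
      mul_pos (sub_pos.2 hum) (mul_pos (by linarith) hyu)
    linarith

end

/-! ### The `δ`-transforms and the cutoff time -/

section

variable {n : ℕ} {V : Fin n → ℝ ≃o ℝ} {b : ℝ}

/-- The right-hand side depends on `i` only through the score level, so bidders with equal scores
share the same value of `u * x_i(u)`; this is what links the transforms to a common price. -/
theorem mul_scoreReducedForm (i : Fin n) {u : ℝ} (hu : 0 ≤ u) (h : 0 ≤ V i u) :
    u * scoreReducedForm V i u = ∏ j, max 0 ((V j).symm (V i u)) := by
  rw [scoreReducedForm, if_pos h, ← Finset.mul_prod_erase _ _ (Finset.mem_univ i),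
    (V i).symm_apply_apply, max_eq_right hu]

theorem mul_scoreReducedForm_of_price {t p : ℝ} {δ : Fin n → ℝ}
    (h : ∀ i, V i (Real.exp (-δ i)) = p) (hs : ∑ i, δ i = t) (hp : 0 ≤ p) (i : Fin n) :
    Real.exp (-δ i) * scoreReducedForm V i (Real.exp (-δ i)) = Real.exp (-t) := by
  rw [mul_scoreReducedForm i (Real.exp_pos _).le (by rw [h]; exact hp), ← hs,
    ← Finset.sum_neg_distrib, Real.exp_sum]
  refine Finset.prod_congr rfl fun j _ => ?_
  rw [h, ← h j, (V j).symm_apply_apply, max_eq_right (Real.exp_pos _).le]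

theorem deltaTransform_eq {x : ℝ → ℝ} {t d : ℝ}
    (h : psiTransform x (Real.exp (-t)) = Real.exp (-d)) : deltaTransform x t = d := by
  rw [deltaTransform, h, Real.log_exp, neg_neg]

/-- As long as the price is nonnegative, the transform follows the solution of the system. -/
theorem deltaTransform_scoreReducedForm {t p : ℝ} {δ : Fin n → ℝ} (hδ : ∀ i, 0 ≤ δ i)
    (h : ∀ i, V i (Real.exp (-δ i)) = p) (hs : ∑ i, δ i = t) (hp : 0 ≤ p) (i : Fin n) :
    deltaTransform (scoreReducedForm V i) t = δ i := by
  apply deltaTransform_eq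
  have hle : Real.exp (-δ i) ≤ 1 := Real.exp_le_one_iff.2 (by linarith [hδ i])
  have hval := mul_scoreReducedForm_of_price h hs hp i
  have hset : {u : ℝ | u ∈ Icc (0 : ℝ) 1 ∧ u * scoreReducedForm V i u ≤ Real.exp (-t)} =
      Icc 0 (Real.exp (-δ i)) := by
    ext u
    simp only [mem_ofPred_eq]
    constructor
    · rintro ⟨hu, hle'⟩
      refine ⟨hu.1, ?_⟩
      by_contra! hlt
      have hx : 0 < scoreReducedForm V i (Real.exp (-δ i)) :=
        pos_of_mul_pos_right (hval ▸ Real.exp_pos (-t)) (Real.exp_pos _).le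
      have := mul_lt_mul hlt (monotone_scoreReducedForm (V := V) i hlt.le) hx hu.1
      linarith
    · intro hu
      refine ⟨⟨hu.1, hu.2.trans hle⟩, ?_⟩
      rw [← hval]
      exact mul_le_mul hu.2 (monotone_scoreReducedForm i hu.2) (scoreReducedForm_nonneg i u)
        (Real.exp_pos _).le
  rw [psiTransform, hset, csSup_Icc (Real.exp_pos _).le]

/-- From the time at which the price vanishes on, the transform stays constant. -/
theorem deltaTransform_scoreReducedForm_of_lt {t₀ t : ℝ} {δ : Fin n → ℝ} (hδ : ∀ i, 0 ≤ δ i)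
    (h : ∀ i, V i (Real.exp (-δ i)) = 0) (hs : ∑ i, δ i = t₀) (ht : t₀ < t) (i : Fin n) :
    deltaTransform (scoreReducedForm V i) t = δ i := by
  apply deltaTransform_eq
  have hle : Real.exp (-δ i) ≤ 1 := Real.exp_le_one_iff.2 (by linarith [hδ i])
  have hval := mul_scoreReducedForm_of_price h hs le_rfl i
  -- At `e^{-δ i}` the score is zero and `u * x_i(u)` jumps from `0` to `e^{-t₀}`, skipping the
  -- level `e^{-t}`; the supremum is the jump point, though not attained.
  have hset : {u : ℝ | u ∈ Icc (0 : ℝ) 1 ∧ u * scoreReducedForm V i u ≤ Real.exp (-t)} =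
      Ico 0 (Real.exp (-δ i)) := by
    ext u
    simp only [mem_ofPred_eq]
    constructor
    · rintro ⟨hu, hle'⟩
      refine ⟨hu.1, ?_⟩
      by_contra! hge
      have h1 := mul_le_mul hge (monotone_scoreReducedForm (V := V) i hge)
        (scoreReducedForm_nonneg i _) hu.1
      have h2 : Real.exp (-t) < Real.exp (-t₀) := Real.exp_lt_exp.2 (by linarith)
      linarith
    · intro hu
      refine ⟨⟨hu.1, hu.2.le.trans hle⟩, ?_⟩
      rw [scoreReducedForm, if_neg, mul_zero]
      · exact (Real.exp_pos _).le
      · rw [not_le, ← h i]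
        exact (V i).strictMono hu.2
  rw [psiTransform, hset, csSup_Ico (Real.exp_pos _)]

/-- Either the price path is always positive, or the cutoff time is a zero of the price. -/
theorem cutoffTime_cases (hV : ∀ i, V i 1 = b) (hb : 0 ≤ b) (hn : 0 < n) {δ : Fin n → ℝ → ℝ}
    {p : ℝ → ℝ} (h : ∀ t, 0 ≤ t → (∀ i, 0 ≤ δ i t) ∧ (∀ i, V i (Real.exp (-δ i t)) = p t) ∧
      ∑ i, δ i t = t) :
    (cutoffTime p = ⊤ ∧ ∀ t, 0 ≤ t → 0 < p t) ∨
      ∃ t₀ : ℝ, 0 ≤ t₀ ∧ cutoffTime p = t₀ ∧ p t₀ = 0 ∧ ∀ t, 0 ≤ t → t ≤ t₀ → 0 ≤ p t := by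
  by_cases hex : ∃ t, 0 ≤ t ∧ p t ≤ 0
  · right
    obtain ⟨t₁, ht₁, hpt₁⟩ := hex
    -- A solution with nonpositive price shows that the zero-score quantile is at least `e^{-δ i t₁}
    -- > 0`, so its logarithm below is meaningful.
    have hpos : ∀ i, 0 < (V i).symm 0 := fun i => by
      refine (Real.exp_pos (-δ i t₁)).trans_le ?_
      rw [(V i).le_symm_apply, (h t₁ ht₁).2.1 i]; exact hpt₁
    have hnn : ∀ i, 0 ≤ -Real.log ((V i).symm 0) := fun i =>
      neg_nonneg.2 (Real.log_nonpos (hpos i).le (symm_le_one hV i hb))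
    -- The time at which the solution of the system has every score equal to zero.
    set t₀ := ∑ i, -Real.log ((V i).symm 0) with ht₀
    have ht₀0 : 0 ≤ t₀ := Finset.sum_nonneg fun i _ => hnn i
    have hp₀ : p t₀ = 0 := ((system_unique hn (h t₀ ht₀0).2.1 (h t₀ ht₀0).2.2
      (p' := 0) (δ' := fun i => -Real.log ((V i).symm 0)) (fun i => by
        rw [neg_neg, Real.exp_log (hpos i), (V i).apply_symm_apply]) ht₀.symm)).2
    have hbefore : ∀ t, 0 ≤ t → t < t₀ → 0 < p t := fun t ht htt => by
      rw [← hp₀]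
      exact system_price_lt (h t ht).2.1 (h t ht).2.2 (h t₀ ht₀0).2.1 (h t₀ ht₀0).2.2 htt
    refine ⟨t₀, ht₀0, ?_, hp₀, fun t ht htt => ?_⟩
    · refine IsLeast.csInf_eq ⟨⟨t₀, ⟨ht₀0, hp₀.le⟩, rfl⟩, ?_⟩
      rintro _ ⟨t, ⟨ht, hpt⟩, rfl⟩
      refine EReal.coe_le_coe_iff.2 ?_
      by_contra! hlt
      exact (hbefore t ht hlt).not_ge hpt
    · rcases htt.eq_or_lt with rfl | hlt
      · exact hp₀.ge
      · exact (hbefore t ht hlt).le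
  · left
    push Not at hex
    refine ⟨?_, hex⟩
    have : {t : ℝ | 0 ≤ t ∧ p t ≤ 0} = ∅ :=
      eq_empty_of_forall_notMem fun t ht => (hex t ht.1).not_ge ht.2
    rw [cutoffTime, this, image_empty, sInf_empty]

theorem deltaTransform_scoreReducedForm_eq_frozenPath (hV : ∀ i, V i 1 = b) (hb : 0 ≤ b)
    (hn : 0 < n) {δ : Fin n → ℝ → ℝ} {p : ℝ → ℝ}
    (h : ∀ t, 0 ≤ t → (∀ i, 0 ≤ δ i t) ∧ (∀ i, V i (Real.exp (-δ i t)) = p t) ∧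
      ∑ i, δ i t = t) (i : Fin n) {t : ℝ} (ht : 0 ≤ t) :
    deltaTransform (scoreReducedForm V i) t = frozenPath (δ i) (cutoffTime p) t := by
  have hfollow : 0 ≤ p t → deltaTransform (scoreReducedForm V i) t = δ i t := fun hp =>
    deltaTransform_scoreReducedForm (h t ht).1 (h t ht).2.1 (h t ht).2.2 hp i
  rcases cutoffTime_cases hV hb hn h with ⟨hT, hpos⟩ | ⟨t₀, ht₀, hT, hp₀, hnn⟩
  · rw [hT, frozenPath, if_pos le_top, hfollow (hpos t ht).le]
  · rw [hT, frozenPath]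
    split_ifs with hle
    · exact hfollow (hnn t ht (EReal.coe_le_coe_iff.1 hle))
    · rw [EReal.toReal_coe]
      obtain ⟨h1, h2, h3⟩ := h t₀ ht₀
      rw [hp₀] at h2
      rw [EReal.coe_le_coe_iff, not_le] at hle
      exact deltaTransform_scoreReducedForm_of_lt h1 h2 h3 hle i

theorem revenue_linear {H : Fin n → ℝ → ℝ → ℝ}
    (hH : ∀ i x, ∀ u ∈ Icc (0 : ℝ) 1, H i x u = V i u * x) (y : Fin n → ℝ → ℝ) :
    revenue H y = ∑ i, ∫ u in (0 : ℝ)..1, V i u * y i u := by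
  refine Finset.sum_congr rfl fun i _ => intervalIntegral.integral_congr fun u hu => ?_
  rw [uIcc_of_le zero_le_one] at hu
  exact hH i _ u hu

end

/-! ### The main theorem -/

theorem proposition3 {n : ℕ} (hn : 0 < n) (A : TypeDistributions n)
    (hTop : ∀ i j, A.hi i = A.hi j)
    (hReg : ∀ i, StrictMonoOn (A.virtualValue i) (Set.Icc (A.lo i) (A.hi i))) :
    (∀ t : ℝ, 0 ≤ t → ∃! s : (Fin n → ℝ) × ℝ, SolvesSystem A.linearH t s.1 s.2) ∧
    ∀ (δ : Fin n → ℝ → ℝ) (p : ℝ → ℝ),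
      (∀ t : ℝ, 0 ≤ t → SolvesSystem A.linearH t (fun i => δ i t) (p t)) →
      ∃ x : Fin n → ℝ → ℝ,
        IsOptimalReducedForm A.linearH x ∧
        (∀ i, ∀ t : ℝ, 0 ≤ t → deltaTransform (x i) t = frozenPath (δ i) (cutoffTime p) t) ∧
        (∀ y : Fin n → ℝ → ℝ, IsOptimalReducedForm A.linearH y →
          ∀ i, Set.EqOn (y i) (x i) (Set.Icc 0 1)) ∧
        (∀ i, IsScore (A.quantileVirtualValue i)) ∧
        Induces (scoreAllocation A.quantileVirtualValue) x := by
  choose V hV1 hVeq using fun i => A.exists_orderIso_quantileVirtualValue i (hReg i)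
  have hV : ∀ i, V i 1 = A.hi ⟨0, hn⟩ := fun i => (hV1 i).trans (hTop i _)
  have hb : 0 < A.hi ⟨0, hn⟩ := (A.lo_nonneg _).trans_lt (A.lo_lt_hi _)
  have hH : ∀ i x, ∀ u ∈ Icc (0 : ℝ) 1, A.linearH i x u = V i u * x := fun i x u hu => by
    rw [← hVeq i hu]; rfl
  have hfeas := isFeasibleReducedForm_scoreReducedForm hV hb.le
  refine ⟨fun t ht => ?_, fun δ p h => ⟨scoreReducedForm V, ⟨hfeas, fun y hy => ?_⟩, ?_,
    fun y hy => ?_, fun i => ⟨?_, fun u hu => ?_⟩, induces_scoreAllocation hVeq hV⟩⟩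
  · obtain ⟨δ, p, hsol⟩ := exists_system_solution hn hV ht
    refine ⟨(δ, p), (solvesSystem_iff hH).2 hsol, fun s hs => ?_⟩
    obtain ⟨_, h1, h2⟩ := (solvesSystem_iff hH).1 hs
    exact Prod.ext_iff.2 (system_unique hn h1 h2 hsol.2.1 hsol.2.2)
  · rw [revenue_linear hH, revenue_linear hH]
    exact sum_integral_score_mul_le hV hb.le hy
  · exact fun i t ht => deltaTransform_scoreReducedForm_eq_frozenPath hV hb.le hn
      (fun t ht => (solvesSystem_iff hH).1 (h t ht)) i ht
  · have hle := hy.2 _ hfeas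
    rw [revenue_linear hH, revenue_linear hH] at hle
    exact eqOn_scoreReducedForm hV hb hy.1 hle
  · exact ((V i).strictMono.strictMonoOn _).congr (hVeq i).symm
  · exact (V i).continuous.continuousWithinAt.congr
      (fun w hw => hVeq i ⟨hu.1.trans hw.1, hw.2⟩) (hVeq i hu)
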